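/- Let $k\ge 2$ and let $q=q_1q_2\cdots q_k$ be a fixed permutation of $\{1,\dots,k\}$ (the pattern). For a permutation $p=p_1p_2\cdots p_n$ of $\{1,\dots,n\}$, an occurrence of $q$ in $p$ is a sequence of positions $1\le i_1<i_2<\cdots<i_k\le n$ such that for all $j,r\in\{1,\dots,k\}$ we have $q_j<q_r$ if and only if $p_{i_j}<p_{i_r}$. Let $X_n$ be the number of occurrences of $q$ in a permutation of length $n$ chosen uniformly at random (each with probability $1/n!$). Then, as $n\to\infty$, \[ \tilde X_n=\frac{X_n-E(X_n)}{\sqrt{\operatorname{Var}(X_n)}} \] converges in distribution to the standard normal variable $N(0,1)$. (For the finitely many $n$ with $\operatorname{Var}(X_n)=0$, put $\tilde X_n=0$.) -/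

import Mathlib

open MeasureTheory ProbabilityTheory Filter

/-- The increasing index sequence `i` (with values among the `n` positions) is an occurrence of the
pattern `q` in the permutation `p`, read as the word `p 0, p 1, …, p (n - 1)`: the entries of `p` in
the positions `i 0 < i 1 < ⋯ < i (k - 1)` are in the same relative order as the entries of `q`. -/
def IsOccurrence {k n : ℕ} (q : Equiv.Perm (Fin k)) (p : Equiv.Perm (Fin n))
    (i : Fin k → Fin n) : Prop :=
  (∀ j r : Fin k, j < r → i j < i r) ∧ ∀ j r : Fin k, q j < q r ↔ p (i j) < p (i r)

instance instDecidableIsOccurrence {k n : ℕ} (q : Equiv.Perm (Fin k)) (p : Equiv.Perm (Fin n))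
    (i : Fin k → Fin n) : Decidable (IsOccurrence q p i) :=
  inferInstanceAs (Decidable
    ((∀ j r : Fin k, j < r → i j < i r) ∧ ∀ j r : Fin k, q j < q r ↔ p (i j) < p (i r)))

/-- The number of occurrences of the pattern `q` in the permutation `p`. -/
def patternCount {k n : ℕ} (q : Equiv.Perm (Fin k)) (p : Equiv.Perm (Fin n)) : ℕ :=
  (Finset.univ.filter fun i : Fin k → Fin n => IsOccurrence q p i).card

/-- Every set of permutations of length `n` is an event. -/
instance instMeasurableSpacePermFin (n : ℕ) : MeasurableSpace (Equiv.Perm (Fin n)) := ⊤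

instance instDiscreteMeasurableSpacePermFin (n : ℕ) :
    DiscreteMeasurableSpace (Equiv.Perm (Fin n)) := ⟨fun _ => trivial⟩

/-- The uniform probability measure on the permutations of length `n`: each of them has
probability `1 / n!`. -/
noncomputable def uniformPerm (n : ℕ) : Measure (Equiv.Perm (Fin n)) :=
  uniformOn Set.univ

instance instIsProbabilityMeasureUniformPerm (n : ℕ) : IsProbabilityMeasure (uniformPerm n) :=
  inferInstanceAs (IsProbabilityMeasure (uniformOn (Set.univ : Set (Equiv.Perm (Fin n)))))

/-- The standardization `(X - E X) / √(Var X)` of a real random variable `X`. -/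
noncomputable def standardize {Ω : Type*} [MeasurableSpace Ω] (μ : Measure Ω) (X : Ω → ℝ) :
    Ω → ℝ :=
  fun ω => (X ω - ∫ ω', X ω' ∂μ) / Real.sqrt (variance X μ)

open scoped BigOperators

/-! The count X is the sum, over all index maps `I`, of the indicators that `I` is an occurrence.
The relative order on a set of positions is independent of every statistic unaffected by shuffling
those positions (`DependsOnOrderOn.expect_mul`), so indicators on disjoint position sets are
independent. The centered indicators thus form N = n^k bounded variables, each overlapping at most Δ
= k² n^(k-1) of them. Stein's method (`norm_expect_exp_sub_le`) bounds the distance between the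
characteristic functions of X, standardized, and of the Gaussian, at a fixed t, by a multiple of
NΔ²/σ³ + √(NΔ³)/σ². This is O(n^(-1/2)) as soon as σ² ≥ c n^(2k-1), and Lévy's continuity theorem
concludes.

The variance bound (`exists_pos_mul_pow_le_variance`) comes from testing X against a simpler
statistic Y: the number of the first m positions whose entries lie in a set A of m extreme values,
with m a small constant fraction of n. According to whether q descends or ascends at its first step,
A consists of the lowest or the highest values, so that an occurrence with its first entry in A also
has its second entry there. Two hits are much rarer than one, hence an occurrence and a hit at its
first position are negatively correlated. Summation gives Cov(X, Y) ≤ -c n^k, while Var Y = O(n);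
Cauchy–Schwarz then bounds Var X from below. -/

/-! ### Independence of relative order and shuffle-invariant statistics -/

/-- `F p` only depends on the relative order of the values of `p` on the positions in `S`. -/
def DependsOnOrderOn {n : ℕ} {β : Type*} (S : Finset (Fin n)) (F : Equiv.Perm (Fin n) → β) : Prop :=
  ∀ p r : Equiv.Perm (Fin n), (∀ x ∈ S, ∀ y ∈ S, p x < p y ↔ r x < r y) → F p = F r

/-- `G` does not change when the values at the positions in `S` are permuted among themselves. -/
def InvariantOn {n : ℕ} {β : Type*} (S : Finset (Fin n)) (G : Equiv.Perm (Fin n) → β) : Prop :=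
  ∀ p σ : Equiv.Perm (Fin n), (∀ x ∉ S, σ x = x) → G (p * σ) = G p

/-- Apply `p` from `S` onto its image, then the unique increasing bijection from that image back to
`S`. -/
theorem exists_perm_subtype_same_order {n : ℕ} (S : Finset (Fin n)) (p : Equiv.Perm (Fin n)) :
    ∃ e : Equiv.Perm S, ∀ x ∈ S, ∀ y ∈ S,
      p x < p y ↔ Equiv.Perm.ofSubtype e x < Equiv.Perm.ofSubtype e y := by
  classical
  set T : Finset (Fin n) := S.map p.toEmbedding with hT
  have hcard : T.card = S.card := Finset.card_map _
  have hmem : ∀ x : Fin n, x ∈ S ↔ p x ∈ T := fun x => by simp [hT]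
  let f : S ≃ T := p.subtypeEquiv hmem
  let g : T ≃o S := (T.orderIsoOfFin hcard).symm.trans (S.orderIsoOfFin rfl)
  refine ⟨f.trans g.toEquiv, fun x hx y hy => ?_⟩
  rw [Equiv.Perm.ofSubtype_apply_of_mem _ hx, Equiv.Perm.ofSubtype_apply_of_mem _ hy]
  change _ ↔ g (f ⟨x, hx⟩) < g (f ⟨y, hy⟩)
  rw [g.lt_iff_lt]
  rfl

theorem expect_mul_perm {n : ℕ} {𝕜 : Type*} [RCLike 𝕜] (σ : Equiv.Perm (Fin n))
    (F : Equiv.Perm (Fin n) → 𝕜) : 𝔼 p, F (p * σ) = 𝔼 p, F p :=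
  Fintype.expect_equiv (Equiv.mulRight σ) _ _ fun _ => rfl

/-- On `S`, `p` can be replaced by some permutation `τ` of `S` with the same relative order, and `e
↦ τ * e` merely reindexes the average. -/
theorem DependsOnOrderOn.expect_perm_subtype {n : ℕ} {𝕜 : Type*} [RCLike 𝕜] {S : Finset (Fin n)}
    {F : Equiv.Perm (Fin n) → 𝕜} (hF : DependsOnOrderOn S F) (p : Equiv.Perm (Fin n)) :
    𝔼 e : Equiv.Perm S, F (p * Equiv.Perm.ofSubtype e) =
      𝔼 e : Equiv.Perm S, F (Equiv.Perm.ofSubtype e) := by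
  obtain ⟨τ, hτ⟩ := exists_perm_subtype_same_order S p
  refine Fintype.expect_equiv (Equiv.mulLeft τ) _ _ fun e => hF _ _ fun x hx y hy => ?_
  rw [Equiv.coe_mulLeft, map_mul]
  exact hτ _ ((Equiv.Perm.ofSubtype_apply_mem_iff_mem e x).2 hx) _
    ((Equiv.Perm.ofSubtype_apply_mem_iff_mem e y).2 hy)

/-- Averaging over right multiplication by the permutations of `S` leaves `G` alone and turns `F`
into a constant. -/
theorem expect_mul_eq_expect_subtype_mul {n : ℕ} {𝕜 : Type*} [RCLike 𝕜] {S : Finset (Fin n)}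
    {F G : Equiv.Perm (Fin n) → 𝕜} (hF : DependsOnOrderOn S F) (hG : InvariantOn S G) :
    𝔼 p, F p * G p = (𝔼 e : Equiv.Perm S, F (Equiv.Perm.ofSubtype e)) * 𝔼 p, G p := by
  have key : ∀ e : Equiv.Perm S,
      𝔼 p, F (p * Equiv.Perm.ofSubtype e) * G p = 𝔼 p, F p * G p := fun e => by
    rw [← expect_mul_perm (Equiv.Perm.ofSubtype e) fun p => F p * G p]
    refine Finset.expect_congr rfl fun p _ => ?_
    rw [hG p _ fun x hx => Equiv.Perm.ofSubtype_apply_of_not_mem e hx]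
  calc 𝔼 p, F p * G p
      = 𝔼 e : Equiv.Perm S, 𝔼 p, F (p * Equiv.Perm.ofSubtype e) * G p := by
        simp_rw [key]; rw [Fintype.expect_const]
    _ = 𝔼 p, (𝔼 e : Equiv.Perm S, F (p * Equiv.Perm.ofSubtype e)) * G p := by
        rw [Finset.expect_comm]; simp_rw [Finset.expect_mul]
    _ = _ := by simp_rw [hF.expect_perm_subtype]; rw [Finset.mul_expect]

theorem DependsOnOrderOn.expect_eq {n : ℕ} {𝕜 : Type*} [RCLike 𝕜] {S : Finset (Fin n)}
    {F : Equiv.Perm (Fin n) → 𝕜} (hF : DependsOnOrderOn S F) :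
    𝔼 p, F p = 𝔼 e : Equiv.Perm S, F (Equiv.Perm.ofSubtype e) := by
  simpa [Fintype.expect_const] using expect_mul_eq_expect_subtype_mul hF (G := fun _ => 1)
    fun _ _ _ => rfl

/-- The relative order on a set of positions is independent of every statistic that is invariant
under rearrangement of these positions. -/
theorem DependsOnOrderOn.expect_mul {n : ℕ} {𝕜 : Type*} [RCLike 𝕜] {S : Finset (Fin n)}
    {F G : Equiv.Perm (Fin n) → 𝕜} (hF : DependsOnOrderOn S F) (hG : InvariantOn S G) :
    𝔼 p, F p * G p = (𝔼 p, F p) * 𝔼 p, G p := by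
  rw [expect_mul_eq_expect_subtype_mul hF hG, hF.expect_eq]

theorem DependsOnOrderOn.mono {n : ℕ} {β : Type*} {S T : Finset (Fin n)}
    {F : Equiv.Perm (Fin n) → β} (hF : DependsOnOrderOn S F) (h : S ⊆ T) : DependsOnOrderOn T F :=
  fun p p' H => hF p p' fun x hx y hy => H x (h hx) y (h hy)

theorem DependsOnOrderOn.comp₂ {n : ℕ} {β γ δ : Type*} {S : Finset (Fin n)}
    {F : Equiv.Perm (Fin n) → β} {G : Equiv.Perm (Fin n) → γ} (hF : DependsOnOrderOn S F)
    (hG : DependsOnOrderOn S G) (f : β → γ → δ) : DependsOnOrderOn S fun p => f (F p) (G p) :=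
  fun p p' H => by simp only [hF p p' H, hG p p' H]

theorem DependsOnOrderOn.invariantOn {n : ℕ} {β : Type*} {S T : Finset (Fin n)}
    {F : Equiv.Perm (Fin n) → β} (hF : DependsOnOrderOn S F) (h : Disjoint S T) :
    InvariantOn T F := fun p σ hσ => hF _ _ fun x hx y hy => by
  rw [Equiv.Perm.mul_apply, Equiv.Perm.mul_apply, hσ x (Finset.disjoint_left.1 h hx),
    hσ y (Finset.disjoint_left.1 h hy)]

/-! ### Stein's method for characteristic functions -/

theorem expect_ofReal {α : Type*} [Fintype α] (f : α → ℝ) :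
    ((𝔼 a, f a : ℝ) : ℂ) = 𝔼 a, (f a : ℂ) := Complex.ofReal_expect _ _

/-- The derivative in `y` has norm at most `|y|`; the mean value inequality suffices, at the cost of
a factor 2 against Taylor's constant. -/
theorem norm_exp_neg_mul_I_sub_one_add_le (y : ℝ) :
    ‖1 - Complex.exp (-(Complex.I * y)) - Complex.I * y‖ ≤ y ^ 2 := by
  have hderiv : ∀ s : ℝ, HasDerivAt
      (fun s : ℝ => 1 - Complex.exp (Complex.I * (-s : ℝ)) - Complex.I * (s : ℝ))
      (Complex.I * (Complex.exp (Complex.I * (-s : ℝ)) - 1)) s := fun s => by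
    have h1 := ((hasDerivAt_id s).neg.ofReal_comp.const_mul Complex.I).cexp
    have h2 := (hasDerivAt_id s).ofReal_comp.const_mul Complex.I
    refine ((h1.const_sub 1).sub h2).congr_deriv ?_
    simp only [Pi.neg_apply, id_eq]
    push_cast
    ring
  have hmv := (convex_closedBall (0 : ℝ) |y|).norm_image_sub_le_of_norm_hasDerivWithin_le
    (fun s _ => (hderiv s).hasDerivWithinAt) (C := |y|) (x := 0) (y := y)
    (fun s hs => by
      rw [norm_mul, Complex.norm_I, one_mul]
      refine Real.norm_exp_I_mul_ofReal_sub_one_le.trans ?_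
      simpa using hs) (by simp) (by simp)
  simpa [← sq] using hmv

/-- A function satisfying the differential equation `φ' = -t φ` of the Gaussian characteristic
function up to a small error is close to it. -/
theorem norm_sub_exp_le_of_hasDerivAt {φ R : ℝ → ℂ} {ε : ℝ} (h0 : φ 0 = 1)
    (hφ : ∀ t : ℝ, HasDerivAt φ (-t * φ t + R t) t) (hR : ∀ t, ‖R t‖ ≤ ε * (|t| + t ^ 2)) (t : ℝ) :
    ‖φ t - Complex.exp (-(t : ℂ) ^ 2 / 2)‖ ≤ ε * (|t| + t ^ 2) * |t| := by
  have hε : 0 ≤ ε := by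
    have := (norm_nonneg _).trans (hR 1)
    norm_num at this
    linarith
  -- Integrating factor: the main term of `φ'` cancels in `ψ'`, leaving only the error `R`.
  set ψ : ℝ → ℂ := fun s => φ s * Complex.exp ((s : ℂ) ^ 2 / 2) with hψ
  have hderiv : ∀ s : ℝ, HasDerivAt ψ (R s * Complex.exp ((s : ℂ) ^ 2 / 2)) s := fun s => by
    have h1 : HasDerivAt (fun s : ℝ => Complex.exp ((s : ℂ) ^ 2 / 2))
        (Complex.exp ((s : ℂ) ^ 2 / 2) * s) s := by
      have h2 : HasDerivAt (fun s : ℝ => (s : ℂ)) 1 s := Complex.ofRealCLM.hasDerivAt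
      have h3 := ((h2.pow 2).div_const 2).cexp
      refine h3.congr_deriv ?_
      simp only [Pi.pow_apply]
      push_cast
      ring
    refine ((hφ s).mul h1).congr_deriv ?_
    ring
  have hb : ∀ s ∈ Metric.closedBall (0 : ℝ) |t|,
      ‖R s * Complex.exp ((s : ℂ) ^ 2 / 2)‖ ≤ ε * (|t| + t ^ 2) * Real.exp (t ^ 2 / 2) := by
    intro s hs
    have hs' : |s| ≤ |t| := by simpa using hs
    have hsq : s ^ 2 ≤ t ^ 2 := sq_le_sq.2 hs'
    rw [norm_mul, Complex.norm_exp]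
    have : ((s : ℂ) ^ 2 / 2).re = s ^ 2 / 2 := by
      rw [show ((s : ℂ) ^ 2 / 2) = ((s ^ 2 / 2 : ℝ) : ℂ) by push_cast; ring, Complex.ofReal_re]
    rw [this]
    have := hR s
    gcongr
    refine (hR s).trans ?_
    gcongr
  have hmv := (convex_closedBall (0 : ℝ) |t|).norm_image_sub_le_of_norm_hasDerivWithin_le
    (fun s _ => (hderiv s).hasDerivWithinAt) hb (x := 0) (y := t) (by simp) (by simp)
  have hψ0 : ψ 0 = 1 := by simp [hψ, h0]
  rw [hψ0, sub_zero, Real.norm_eq_abs] at hmv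
  have hexp : Complex.exp ((t : ℂ) ^ 2 / 2) * Complex.exp (-(t : ℂ) ^ 2 / 2) = 1 := by
    rw [← Complex.exp_add, ← add_div, add_neg_cancel, zero_div, Complex.exp_zero]
  have heq : φ t - Complex.exp (-(t : ℂ) ^ 2 / 2)
      = (ψ t - 1) * Complex.exp (-(t : ℂ) ^ 2 / 2) := by
    rw [sub_mul, one_mul, hψ, mul_assoc, hexp, mul_one]
  rw [heq, norm_mul, Complex.norm_exp]
  have : (-(t : ℂ) ^ 2 / 2).re = -(t ^ 2 / 2) := by
    rw [show (-(t : ℂ) ^ 2 / 2) = ((-(t ^ 2 / 2) : ℝ) : ℂ) by push_cast; ring, Complex.ofReal_re]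
  rw [this, Real.exp_neg]
  calc _ ≤ (ε * (|t| + t ^ 2) * Real.exp (t ^ 2 / 2) * |t|) * (Real.exp (t ^ 2 / 2))⁻¹ := by
        gcongr
    _ = _ := by field_simp

theorem sum_ite_dependent_le {ι : Type*} [Fintype ι] {D : ι → ι → Prop} [DecidableRel D]
    {Δ : ℕ} (hΔ : ∀ i, (Finset.univ.filter (D i)).card ≤ Δ) (i : ι) :
    ∑ j, (if D i j then (1 : ℝ) else 0) ≤ Δ := by
  rw [Finset.sum_boole]; exact_mod_cast hΔ i

/-- The variance of `∑ i, X i * ∑ j ∼ i, X j`. -/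
theorem expect_sq_sum_dependent_sub_le {Ω ι : Type*} [Fintype Ω] [Nonempty Ω] [Fintype ι]
    (X : ι → Ω → ℝ)
    (D : ι → ι → Prop) [DecidableRel D] (hD : ∀ i j, D i j → D j i) (Δ : ℕ)
    (hΔ : ∀ i, (Finset.univ.filter (D i)).card ≤ Δ) (hX : ∀ i ω, |X i ω| ≤ 1)
    (h2 : ∀ i j k l, ¬ D i k → ¬ D i l → ¬ D j k → ¬ D j l →
      𝔼 ω, X i ω * X j ω * (X k ω * X l ω) = (𝔼 ω, X i ω * X j ω) * 𝔼 ω, X k ω * X l ω)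
    (v : ℝ) (hv : v = 𝔼 ω, ∑ i, X i ω * ∑ j with D i j, X j ω) :
    𝔼 ω, (∑ i, X i ω * ∑ j with D i j, X j ω - v) ^ 2 ≤ 8 * Fintype.card ι * Δ ^ 3 := by
  set d : ι → ι → ℝ := fun i j => if D i j then 1 else 0 with hd
  have d0 : ∀ i j, 0 ≤ d i j := fun i j => by simp only [hd]; split_ifs <;> norm_num
  have d1 : ∀ i j, d i j ≤ 1 := fun i j => by simp only [hd]; split_ifs <;> norm_num
  have ds : ∀ i j, d i j = d j i := fun i j => by
    simp only [hd, show D i j ↔ D j i from ⟨hD i j, hD j i⟩]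
  have hsum : ∀ i, ∑ j, d i j ≤ Δ := sum_ite_dependent_le hΔ
  have hV : ∀ ω, ∑ i, X i ω * ∑ j with D i j, X j ω = ∑ a : ι × ι, d a.1 a.2 * (X a.1 ω * X a.2 ω) :=
    fun ω => by
      rw [Fintype.sum_prod_type]
      refine Finset.sum_congr rfl fun i _ => ?_
      rw [Finset.mul_sum, Finset.sum_filter]
      refine Finset.sum_congr rfl fun j _ => ?_
      simp only [hd]; split_ifs <;> simp
  set c : ι × ι → ι × ι → ℝ := fun a b => 𝔼 ω, X a.1 ω * X a.2 ω * (X b.1 ω * X b.2 ω) -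
    (𝔼 ω, X a.1 ω * X a.2 ω) * 𝔼 ω, X b.1 ω * X b.2 ω with hc
  have hX2 : ∀ i j ω, |X i ω * X j ω| ≤ 1 := fun i j ω => by
    rw [abs_mul]; exact mul_le_one₀ (hX i ω) (abs_nonneg _) (hX j ω)
  have hE : ∀ f : Ω → ℝ, (∀ ω, |f ω| ≤ 1) → |𝔼 ω, f ω| ≤ 1 := fun f hf =>
    (Finset.abs_expect_le _ _).trans (Finset.expect_le Finset.univ_nonempty fun ω _ => hf ω)
  have hc2 : ∀ a b, c a b ≤ 2 := fun a b => by
    have e1 := hE (fun ω => X a.1 ω * X a.2 ω * (X b.1 ω * X b.2 ω)) fun ω => by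
      rw [abs_mul]; exact mul_le_one₀ (hX2 _ _ ω) (abs_nonneg _) (hX2 _ _ ω)
    have e2 : |(𝔼 ω, X a.1 ω * X a.2 ω) * 𝔼 ω, X b.1 ω * X b.2 ω| ≤ 1 := by
      rw [abs_mul]; exact mul_le_one₀ (hE _ (hX2 _ _)) (abs_nonneg _) (hE _ (hX2 _ _))
    have := le_abs_self (𝔼 ω, X a.1 ω * X a.2 ω * (X b.1 ω * X b.2 ω))
    have := neg_abs_le ((𝔼 ω, X a.1 ω * X a.2 ω) * 𝔼 ω, X b.1 ω * X b.2 ω)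
    simp only [hc]; linarith
  -- The covariance of two pair products vanishes unless some edge joins the pairs, so the four
  -- possible edges can be summed as a union bound.
  have hcd : ∀ a b : ι × ι, c a b ≤ 2 * (d a.1 b.1 + d a.1 b.2 + d a.2 b.1 + d a.2 b.2) := by
    intro a b
    by_cases h : D a.1 b.1 ∨ D a.1 b.2 ∨ D a.2 b.1 ∨ D a.2 b.2
    · have : 1 ≤ d a.1 b.1 + d a.1 b.2 + d a.2 b.1 + d a.2 b.2 := by
        have := d0 a.1 b.1; have := d0 a.1 b.2; have := d0 a.2 b.1; have := d0 a.2 b.2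
        have one : ∀ i j, D i j → d i j = 1 := fun i j h => if_pos h
        rcases h with h | h | h | h <;> have := one _ _ h <;> linarith
      linarith [hc2 a b]
    · push Not at h
      have : c a b = 0 := by
        simp only [hc]; rw [h2 _ _ _ _ h.1 h.2.1 h.2.2.1 h.2.2.2, sub_self]
      rw [this]
      have := d0 a.1 b.1; have := d0 a.1 b.2; have := d0 a.2 b.1; have := d0 a.2 b.2
      positivity
  have hexpand : 𝔼 ω, (∑ i, X i ω * ∑ j with D i j, X j ω - v) ^ 2 =
      ∑ a : ι × ι, ∑ b : ι × ι, d a.1 a.2 * d b.1 b.2 * c a b := by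
    have hv' : v = ∑ a : ι × ι, d a.1 a.2 * 𝔼 ω, X a.1 ω * X a.2 ω := by
      rw [hv]; simp_rw [hV]
      rw [Finset.expect_sum_comm]
      simp_rw [Finset.mul_expect]
    have h1 : ∀ ω, (∑ i, X i ω * ∑ j with D i j, X j ω - v) ^ 2 =
        ∑ a : ι × ι, ∑ b : ι × ι, d a.1 a.2 * d b.1 b.2 *
          ((X a.1 ω * X a.2 ω - 𝔼 ω, X a.1 ω * X a.2 ω) *
            (X b.1 ω * X b.2 ω - 𝔼 ω, X b.1 ω * X b.2 ω)) := fun ω => by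
      rw [hV, hv', ← Finset.sum_sub_distrib, sq, Finset.sum_mul_sum]
      refine Finset.sum_congr rfl fun a _ => Finset.sum_congr rfl fun b _ => ?_
      ring
    simp_rw [h1]
    rw [Finset.expect_sum_comm]
    refine Finset.sum_congr rfl fun a _ => ?_
    rw [Finset.expect_sum_comm]
    refine Finset.sum_congr rfl fun b _ => ?_
    rw [← Finset.mul_expect]
    congr 1
    simp only [hc, sub_mul, mul_sub, Finset.expect_sub_distrib, ← Finset.mul_expect,
      ← Finset.expect_mul, Fintype.expect_const]
    ring
  rw [hexpand]
  -- Counts paths of length two starting at `i`. With the edge inside `a` this gives at most `card ι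
  -- * Δ ^ 3` configurations per joining edge; the 8 is 2 for the covariance times 4 joining edges.
  have hA : ∀ i, ∑ k, ∑ l, d i k * d k l ≤ (Δ : ℝ) ^ 2 := fun i => by
    calc ∑ k, ∑ l, d i k * d k l = ∑ k, d i k * ∑ l, d k l := by simp_rw [Finset.mul_sum]
      _ ≤ ∑ k, d i k * Δ := Finset.sum_le_sum fun k _ => mul_le_mul_of_nonneg_left (hsum k) (d0 _ _)
      _ = (∑ k, d i k) * Δ := by rw [Finset.sum_mul]
      _ ≤ Δ * Δ := mul_le_mul_of_nonneg_right (hsum i) (Nat.cast_nonneg _)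
      _ = _ := by ring
  have hB : ∀ i, ∑ b : ι × ι, d b.1 b.2 * (d i b.1 + d i b.2) ≤ 2 * (Δ : ℝ) ^ 2 := fun i => by
    have e1 : ∑ b : ι × ι, d b.1 b.2 * d i b.1 ≤ (Δ : ℝ) ^ 2 := by
      rw [Fintype.sum_prod_type]
      refine le_trans (le_of_eq ?_) (hA i)
      exact Finset.sum_congr rfl fun k _ => Finset.sum_congr rfl fun l _ => mul_comm _ _
    have e2 : ∑ b : ι × ι, d b.1 b.2 * d i b.2 ≤ (Δ : ℝ) ^ 2 := by
      rw [Fintype.sum_prod_type_right]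
      refine le_trans (le_of_eq ?_) (hA i)
      exact Finset.sum_congr rfl fun k _ => Finset.sum_congr rfl fun l _ => by rw [mul_comm, ds l k]
    simp_rw [mul_add]
    rw [Finset.sum_add_distrib]
    linarith
  have hC : ∑ a : ι × ι, d a.1 a.2 ≤ Fintype.card ι * Δ := by
    rw [Fintype.sum_prod_type]
    calc _ ≤ ∑ _i : ι, (Δ : ℝ) := Finset.sum_le_sum fun i _ => hsum i
      _ = _ := by simp
  calc ∑ a : ι × ι, ∑ b : ι × ι, d a.1 a.2 * d b.1 b.2 * c a b
      ≤ ∑ a : ι × ι, ∑ b : ι × ι, d a.1 a.2 * d b.1 b.2 *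
          (2 * (d a.1 b.1 + d a.1 b.2 + d a.2 b.1 + d a.2 b.2)) := by
        refine Finset.sum_le_sum fun a _ => Finset.sum_le_sum fun b _ => ?_
        exact mul_le_mul_of_nonneg_left (hcd a b) (mul_nonneg (d0 _ _) (d0 _ _))
    _ = ∑ a : ι × ι, d a.1 a.2 * (2 * (∑ b : ι × ι, d b.1 b.2 * (d a.1 b.1 + d a.1 b.2) +
          ∑ b : ι × ι, d b.1 b.2 * (d a.2 b.1 + d a.2 b.2))) := by
        refine Finset.sum_congr rfl fun a _ => ?_
        rw [← Finset.sum_add_distrib, Finset.mul_sum, Finset.mul_sum]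
        exact Finset.sum_congr rfl fun b _ => by ring
    _ ≤ ∑ a : ι × ι, d a.1 a.2 * (2 * (2 * (Δ : ℝ) ^ 2 + 2 * (Δ : ℝ) ^ 2)) := by
        refine Finset.sum_le_sum fun a _ => mul_le_mul_of_nonneg_left ?_ (d0 _ _)
        have := hB a.1; have := hB a.2
        linarith
    _ = (∑ a : ι × ι, d a.1 a.2) * (8 * (Δ : ℝ) ^ 2) := by rw [← Finset.sum_mul]; ring
    _ ≤ (Fintype.card ι * Δ) * (8 * (Δ : ℝ) ^ 2) := by gcongr
    _ = _ := by ring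

/-- Stein's method for characteristic functions: a quantitative central limit theorem for sums of
bounded centered random variables with a dependency graph. -/
theorem norm_expect_exp_sub_le {Ω ι : Type*} [Fintype Ω] [Nonempty Ω] [Fintype ι] (X : ι → Ω → ℝ)
    (D : ι → ι → Prop) [DecidableRel D] (hD : ∀ i j, D i j → D j i) (Δ : ℕ)
    (hΔ : ∀ i, (Finset.univ.filter (D i)).card ≤ Δ) (hX : ∀ i ω, |X i ω| ≤ 1)
    (h0 : ∀ i j, ¬ D i j → 𝔼 ω, X i ω * X j ω = 0)
    (h1 : ∀ i (s : ℝ), 𝔼 ω, (X i ω : ℂ) *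
      Complex.exp (Complex.I * (s * ∑ j with ¬ D i j, X j ω : ℝ)) = 0)
    (h2 : ∀ i j k l, ¬ D i k → ¬ D i l → ¬ D j k → ¬ D j l →
      𝔼 ω, X i ω * X j ω * (X k ω * X l ω) = (𝔼 ω, X i ω * X j ω) * 𝔼 ω, X k ω * X l ω)
    (σ : ℝ) (hσ : 0 < σ) (hσ2 : 𝔼 ω, (∑ i, X i ω) ^ 2 = σ ^ 2) (t : ℝ) :
    ‖𝔼 ω, Complex.exp (Complex.I * (t * ((∑ i, X i ω) / σ) : ℝ)) - Complex.exp (-(t : ℂ) ^ 2 / 2)‖ ≤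
      (Fintype.card ι * Δ ^ 2 / σ ^ 3 + √(8 * Fintype.card ι * Δ ^ 3) / σ ^ 2) *
        (|t| + t ^ 2) * |t| := by
  set N : ℝ := (Fintype.card ι : ℝ) with hN
  set S : Ω → ℝ := fun ω => ∑ i, X i ω with hS
  set T : ι → Ω → ℝ := fun i ω => ∑ j with D i j, X j ω with hT
  set V : Ω → ℝ := fun ω => ∑ i, X i ω * T i ω with hV
  set e : ℝ → Ω → ℂ := fun s ω => Complex.exp (Complex.I * (s * S ω : ℝ)) with he
  have hnorm : ∀ s ω, ‖e s ω‖ = 1 := fun s ω => by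
    simp only [he]; rw [mul_comm, Complex.norm_exp_ofReal_mul_I]
  have hsplit : ∀ i ω, S ω = T i ω + ∑ j with ¬ D i j, X j ω := fun i ω =>
    (Finset.sum_filter_add_sum_filter_not _ _ _).symm
  have hEV : 𝔼 ω, V ω = σ ^ 2 := by
    rw [← hσ2]
    have : ∀ ω, (∑ i, X i ω) ^ 2 = V ω + ∑ i, ∑ j with ¬ D i j, X i ω * X j ω := fun ω => by
      simp only [hV]
      rw [sq, Finset.sum_mul, ← Finset.sum_add_distrib]
      refine Finset.sum_congr rfl fun i _ => ?_
      rw [← Finset.mul_sum, ← mul_add, ← hsplit]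
    simp_rw [this]
    have hz : 𝔼 ω, ∑ i, ∑ j with ¬D i j, X i ω * X j ω = 0 := by
      rw [Finset.expect_sum_comm]
      refine Finset.sum_eq_zero fun i _ => ?_
      rw [Finset.expect_sum_comm]
      exact Finset.sum_eq_zero fun j hj => h0 i j (Finset.mem_filter.1 hj).2
    rw [Finset.expect_add_distrib, hz, add_zero]
  have hvar : 𝔼 ω, (V ω - σ ^ 2) ^ 2 ≤ 8 * N * Δ ^ 3 :=
    expect_sq_sum_dependent_sub_le X D hD Δ hΔ hX h2 (σ ^ 2) hEV.symm
  -- Cauchy–Schwarz against the constant 1.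
  have habs : 𝔼 ω, |V ω - σ ^ 2| ≤ √(8 * N * Δ ^ 3) := by
    apply Real.le_sqrt_of_sq_le
    refine le_trans ?_ hvar
    have := Finset.expect_mul_sq_le_sq_mul_sq (Finset.univ : Finset Ω) (fun ω => |V ω - σ ^ 2|)
      fun _ => 1
    simpa [Fintype.expect_const] using this
  have hTb : ∀ i ω, |T i ω| ≤ Δ := fun i ω => by
    calc |T i ω| ≤ ∑ j with D i j, |X j ω| := Finset.abs_sum_le_sum_abs _ _
      _ ≤ ∑ j with D i j, (1 : ℝ) := Finset.sum_le_sum fun j _ => hX j ω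
      _ ≤ Δ := by simpa using hΔ i
  have hN0 : 0 ≤ N := Nat.cast_nonneg _
  set φ : ℝ → ℂ := fun t => 𝔼 ω, e (t / σ) ω with hφ
  -- Defined as the defect in the equation φ' = -tφ; the rest of the proof shows that it is small.
  set R : ℝ → ℂ := fun t => Complex.I / σ * 𝔼 ω, (S ω : ℂ) * e (t / σ) ω + t * φ t with hR
  have hderiv : ∀ t : ℝ, HasDerivAt φ (-t * φ t + R t) t := fun t => by
    have h3 : HasDerivAt φ (𝔼 ω, e (t / σ) ω * (Complex.I * (S ω / σ : ℝ))) t := by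
      simp only [hφ, Fintype.expect_eq_sum_div_card]
      refine (HasDerivAt.fun_sum fun ω _ => ?_).div_const _
      have h4 : HasDerivAt (fun s : ℝ => ((s / σ * S ω : ℝ) : ℂ)) ((S ω / σ : ℝ) : ℂ) t := by
        refine HasDerivAt.ofReal_comp ?_
        refine (((hasDerivAt_id t).div_const σ).mul_const (S ω)).congr_deriv ?_
        ring
      exact (h4.const_mul Complex.I).cexp
    refine h3.congr_deriv ?_
    have : -t * φ t + R t = Complex.I / σ * 𝔼 ω, (S ω : ℂ) * e (t / σ) ω := by
      simp only [hR]; ring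
    rw [this, Finset.mul_expect]
    refine Finset.expect_congr rfl fun ω _ => ?_
    push_cast
    ring
  have hRb : ∀ t, ‖R t‖ ≤ (N * Δ ^ 2 / σ ^ 3 + √(8 * N * Δ ^ 3) / σ ^ 2) * (|t| + t ^ 2) := by
    intro t
    set s := t / σ with hs
    -- By `h1`, removing the neighbours of `i` from the exponent makes the term of `X i` vanish.
    -- Subtracting this zero leaves the factor 1 - exp(-isT_i), whose linear part isT_i sums to the
    -- term with `V`.
    have hmain : 𝔼 ω, (S ω : ℂ) * e s ω = Complex.I * s * (𝔼 ω, (V ω : ℂ) * e s ω) +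
        𝔼 ω, ∑ i, (X i ω : ℂ) * e s ω *
          (1 - Complex.exp (-(Complex.I * (s * T i ω : ℝ))) - Complex.I * (s * T i ω : ℝ)) := by
      have h5 : ∀ i, 𝔼 ω, (X i ω : ℂ) * e s ω * Complex.exp (-(Complex.I * (s * T i ω : ℝ))) = 0 := by
        intro i
        rw [← h1 i s]
        refine Finset.expect_congr rfl fun ω _ => ?_
        rw [mul_assoc]
        simp only [he]
        rw [← Complex.exp_add, hsplit i ω]
        congr 2
        push_cast
        ring
      have h6 : (0 : ℂ) =
          𝔼 ω, ∑ i, (X i ω : ℂ) * e s ω * Complex.exp (-(Complex.I * (s * T i ω : ℝ))) := by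
        rw [Finset.expect_sum_comm, Finset.sum_eq_zero fun i _ => h5 i]
      rw [← sub_zero (𝔼 ω, (S ω : ℂ) * e s ω), h6, ← Finset.expect_sub_distrib, Finset.mul_expect,
        ← Finset.expect_add_distrib]
      refine Finset.expect_congr rfl fun ω _ => ?_
      simp only [hS, hV]
      push_cast
      rw [Finset.sum_mul, Finset.sum_mul, Finset.mul_sum, ← Finset.sum_sub_distrib,
        ← Finset.sum_add_distrib]
      refine Finset.sum_congr rfl fun i _ => ?_
      ring
    have herr : ‖𝔼 ω, ∑ i, (X i ω : ℂ) * e s ω *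
          (1 - Complex.exp (-(Complex.I * (s * T i ω : ℝ))) - Complex.I * (s * T i ω : ℝ))‖ ≤
        N * (s ^ 2 * Δ ^ 2) := by
      refine (RCLike.norm_expect_le (K := ℝ)).trans (Finset.expect_le Finset.univ_nonempty fun ω _ => ?_)
      refine (norm_sum_le _ _).trans ?_
      calc _ ≤ ∑ _i : ι, s ^ 2 * (Δ : ℝ) ^ 2 := Finset.sum_le_sum fun i _ => ?_
        _ = _ := by simp [hN]
      rw [norm_mul, norm_mul, hnorm, mul_one, Complex.norm_real, Real.norm_eq_abs]
      have := norm_exp_neg_mul_I_sub_one_add_le (s * T i ω)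
      calc _ ≤ 1 * (s * T i ω) ^ 2 := by gcongr; exact hX i ω
        _ = s ^ 2 * |T i ω| ^ 2 := by rw [sq_abs]; ring
        _ ≤ _ := by gcongr; exact hTb i ω
    -- `V` concentrates around its mean σ², so it may be replaced by σ² inside the expectation.
    have hfl : ‖𝔼 ω, (V ω : ℂ) * e s ω - σ ^ 2 * φ t‖ ≤ √(8 * N * Δ ^ 3) := by
      simp only [hφ]
      rw [Finset.mul_expect, ← Finset.expect_sub_distrib]
      refine (RCLike.norm_expect_le (K := ℝ)).trans (le_trans (le_of_eq ?_) habs)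
      refine Finset.expect_congr rfl fun ω _ => ?_
      rw [← sub_mul, norm_mul, hnorm, mul_one, ← Real.norm_eq_abs, ← Complex.norm_real]
      push_cast
      rfl
    have hRe : R t = -(s / σ : ℝ) * (𝔼 ω, (V ω : ℂ) * e s ω - σ ^ 2 * φ t) + Complex.I / σ *
        𝔼 ω, ∑ i, (X i ω : ℂ) * e s ω *
          (1 - Complex.exp (-(Complex.I * (s * T i ω : ℝ))) - Complex.I * (s * T i ω : ℝ)) := by
      simp only [hR]
      rw [hmain]
      have hσc : (σ : ℂ) ≠ 0 := by exact_mod_cast hσ.ne'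
      have hst : (t : ℂ) = s * σ := by rw [hs]; push_cast; field_simp
      rw [hst]
      push_cast
      field_simp
      linear_combination (s * 𝔼 ω, (V ω : ℂ) * e s ω) * Complex.I_sq
    rw [hRe]
    refine (norm_add_le _ _).trans ?_
    rw [norm_mul, norm_mul, norm_neg, Complex.norm_real, norm_div Complex.I, Complex.norm_I,
      Complex.norm_real, Real.norm_eq_abs, Real.norm_eq_abs, abs_of_pos hσ]
    calc _ ≤ |s / σ| * √(8 * N * Δ ^ 3) + 1 / σ * (N * (s ^ 2 * Δ ^ 2)) := by gcongr
      _ = √(8 * N * Δ ^ 3) / σ ^ 2 * |t| + N * Δ ^ 2 / σ ^ 3 * t ^ 2 := by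
        rw [hs, abs_div, abs_div, abs_of_pos hσ]
        field_simp
      _ ≤ √(8 * N * Δ ^ 3) / σ ^ 2 * (|t| + t ^ 2) + N * Δ ^ 2 / σ ^ 3 * (|t| + t ^ 2) := by
        gcongr
        · nlinarith [sq_nonneg t]
        · nlinarith [abs_nonneg t]
      _ = _ := by ring
  have := norm_sub_exp_le_of_hasDerivAt (φ := φ) (by simp [hφ, he]) hderiv hRb t
  convert this using 3
  refine Finset.expect_congr rfl fun ω _ => ?_
  simp only [he]
  congr 3
  ring

/-! ### Indicators of occurrences and of hits -/

/-- The indicator of the event that `I` is an occurrence of `q`. -/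
noncomputable def occInd {k n : ℕ} (q : Equiv.Perm (Fin k)) (I : Fin k → Fin n)
    (p : Equiv.Perm (Fin n)) : ℝ :=
  if IsOccurrence q p I then 1 else 0

/-- The indicator of the event that the entry in position `i` belongs to `A`. -/
noncomputable def hitInd {n : ℕ} (A : Finset (Fin n)) (i : Fin n) (p : Equiv.Perm (Fin n)) : ℝ :=
  if p i ∈ A then 1 else 0

section Indicators

variable {k n : ℕ} (q : Equiv.Perm (Fin k)) (I : Fin k → Fin n) (A : Finset (Fin n))

theorem patternCount_eq_sum_occInd (p : Equiv.Perm (Fin n)) :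
    (patternCount q p : ℝ) = ∑ I : Fin k → Fin n, occInd q I p := by
  simp only [occInd, patternCount, Finset.sum_boole]

theorem occInd_nonneg (p : Equiv.Perm (Fin n)) : 0 ≤ occInd q I p := by
  unfold occInd; split_ifs <;> norm_num

theorem occInd_le_one (p : Equiv.Perm (Fin n)) : occInd q I p ≤ 1 := by
  unfold occInd; split_ifs <;> norm_num

theorem hitInd_nonneg (i : Fin n) (p : Equiv.Perm (Fin n)) : 0 ≤ hitInd A i p := by
  unfold hitInd; split_ifs <;> norm_num

theorem hitInd_mul_self (i : Fin n) (p : Equiv.Perm (Fin n)) :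
    hitInd A i p * hitInd A i p = hitInd A i p := by
  unfold hitInd; split_ifs <;> norm_num

variable {I} in
theorem occInd_eq_zero (hI : ¬ StrictMono I) (p : Equiv.Perm (Fin n)) : occInd q I p = 0 :=
  if_neg fun h => hI fun j r hjr => h.1 j r hjr

theorem dependsOnOrderOn_occInd : DependsOnOrderOn (Finset.univ.image I) (occInd q I) := by
  intro p p' h
  have : IsOccurrence q p I ↔ IsOccurrence q p' I := by
    unfold IsOccurrence
    refine and_congr_right fun _ => forall_congr' fun j => forall_congr' fun r => ?_
    rw [h (I j) (by simp) (I r) (by simp)]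
  simp only [occInd, this]

variable {I} in
theorem invariantOn_hitInd {i : Fin n} (hi : i ∉ Finset.univ.image I) :
    InvariantOn (Finset.univ.image I) (hitInd A i) := fun p σ hσ => by
  simp only [hitInd, Equiv.Perm.mul_apply, hσ i hi]

variable {I} in
/-- Increasing positions carry the pattern `q` with probability at least `1 / k!`. -/
theorem inv_factorial_le_expect_occInd (hI : StrictMono I) :
    ((k.factorial : ℝ))⁻¹ ≤ 𝔼 p, occInd q I p := by
  classical
  rw [(dependsOnOrderOn_occInd q I).expect_eq, Fintype.expect_eq_sum_div_card]
  set S : Finset (Fin n) := Finset.univ.image I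
  have hcard : Fintype.card (Equiv.Perm S) = k.factorial := by
    rw [Fintype.card_perm, Fintype.card_coe, Finset.card_image_of_injective _ hI.injective,
      Finset.card_univ, Fintype.card_fin]
  -- Of the k! arrangements of `S`, this one carries `q` along `I`; a single favourable arrangement
  -- is enough.
  set τ : Equiv.Perm (Fin n) := q.viaFintypeEmbedding ⟨I, hI.injective⟩
  have hτI : ∀ j, τ (I j) = I (q j) := fun j =>
    Equiv.Perm.viaFintypeEmbedding_apply_image q ⟨I, hI.injective⟩ j
  have hmem : ∀ x, τ x ∈ S ↔ x ∈ S := by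
    intro x
    by_cases hx : x ∈ S
    · obtain ⟨j, -, rfl⟩ := Finset.mem_image.1 hx
      simp [S, hτI]
    · have : τ x = x := Equiv.Perm.viaFintypeEmbedding_apply_notMem_range q _
        (by simpa [S] using hx)
      rw [this]
  have hfix : ∀ x, τ x ≠ x → x ∈ S := fun x hx => by
    by_contra h
    exact hx (Equiv.Perm.viaFintypeEmbedding_apply_notMem_range q _ (by simpa [S] using h))
  have hone : occInd q I (Equiv.Perm.ofSubtype (τ.subtypePerm hmem : Equiv.Perm S)) = 1 := by
    rw [Equiv.Perm.ofSubtype_subtypePerm hmem hfix]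
    refine if_pos ⟨fun j r h => hI h, fun j r => ?_⟩
    rw [hτI, hτI, hI.lt_iff_lt]
  rw [hcard, inv_eq_one_div]
  gcongr
  rw [← hone]
  exact Finset.single_le_sum (f := fun e : Equiv.Perm S => occInd q I (Equiv.Perm.ofSubtype e))
    (fun e _ => occInd_nonneg q I _) (Finset.mem_univ _)

end Indicators

/-! ### First and second moments of hits -/

section Hits

variable {n : ℕ} (A : Finset (Fin n))

theorem sum_hitInd (p : Equiv.Perm (Fin n)) : ∑ i, hitInd A i p = A.card := by
  unfold hitInd
  rw [Equiv.sum_comp p fun v => if v ∈ A then (1 : ℝ) else 0]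
  simp

theorem hitInd_mul_swap (i j : Fin n) (p : Equiv.Perm (Fin n)) :
    hitInd A i (p * Equiv.swap i j) = hitInd A j p := by
  simp [hitInd]

theorem hitInd_mul_swap_of_ne {i j l : Fin n} (hi : l ≠ i) (hj : l ≠ j) (p : Equiv.Perm (Fin n)) :
    hitInd A l (p * Equiv.swap i j) = hitInd A l p := by
  simp [hitInd, Equiv.swap_apply_of_ne_of_ne hi hj]

/-- All positions are exchangeable, and the hits over all positions add up to the constant `A.card`.
-/
theorem expect_hitInd (i : Fin n) : 𝔼 p, hitInd A i p = A.card / n := by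
  have hn : (n : ℝ) ≠ 0 := by
    have := i.pos; positivity
  have h : ∀ j, 𝔼 p, hitInd A j p = 𝔼 p, hitInd A i p := fun j => by
    rw [← expect_mul_perm (Equiv.swap j i)]
    simp_rw [hitInd_mul_swap]
  have : ∑ j, 𝔼 p, hitInd A j p = A.card := by
    rw [← Finset.expect_sum_comm]
    simp_rw [sum_hitInd]
    exact Fintype.expect_const _
  simp_rw [h] at this
  rw [Finset.sum_const, Finset.card_univ, Fintype.card_fin, nsmul_eq_mul] at this
  rw [eq_div_iff hn, mul_comm, this]

/-- The events that the entries in two given positions belong to `A` are negatively correlated. -/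
theorem expect_hitInd_mul_le {i j : Fin n} (hij : j ≠ i) :
    𝔼 p, hitInd A i p * hitInd A j p ≤ ((A.card : ℝ) / n) ^ 2 := by
  have hn : 2 ≤ n := by
    have h1 := i.2; have h2 := j.2
    have : (j : ℕ) ≠ i := fun h => hij (Fin.ext h)
    omega
  have h : ∀ l ∈ Finset.univ.erase i,
      𝔼 p, hitInd A i p * hitInd A l p = 𝔼 p, hitInd A i p * hitInd A j p := fun l hl => by
    rw [← expect_mul_perm (Equiv.swap l j)]
    simp_rw [hitInd_mul_swap, hitInd_mul_swap_of_ne A (Finset.ne_of_mem_erase hl).symm hij.symm]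
  -- Given a hit at `i`, exactly `A.card - 1` hits remain; by exchangeability each other position
  -- gets an equal share.
  have hs : ∑ l ∈ Finset.univ.erase i, 𝔼 p, hitInd A i p * hitInd A l p =
      ((A.card : ℝ) - 1) * (A.card / n) := by
    rw [← Finset.expect_sum_comm, ← expect_hitInd A i, Finset.mul_expect]
    refine Finset.expect_congr rfl fun p _ => ?_
    rw [← Finset.mul_sum, ← sum_hitInd A p, ← Finset.add_sum_erase _ _ (Finset.mem_univ i)]
    linear_combination -hitInd_mul_self A i p
  rw [Finset.sum_congr rfl h, Finset.sum_const, Finset.card_erase_of_mem (Finset.mem_univ _),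
    Finset.card_univ, Fintype.card_fin, nsmul_eq_mul, Nat.cast_sub (by omega), Nat.cast_one] at hs
  have hn' : (2 : ℝ) ≤ n := by exact_mod_cast hn
  have hA : (A.card : ℝ) ≤ n := by
    have := Finset.card_le_univ A
    rw [Fintype.card_fin] at this
    exact_mod_cast this
  have hA0 : (0 : ℝ) ≤ A.card := Nat.cast_nonneg _
  have hle : ((A.card : ℝ) - 1) ≤ (n - 1) * (A.card / n) := by
    rw [mul_div_assoc', le_div_iff₀ (by linarith)]
    nlinarith
  have : ((n : ℝ) - 1) * 𝔼 p, hitInd A i p * hitInd A j p ≤ (n - 1) * (A.card / n) ^ 2 := by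
    rw [hs, sq, ← mul_assoc]
    gcongr
  exact le_of_mul_le_mul_left this (by linarith)

/-- Negative correlation allows the off-diagonal covariances to be dropped. -/
theorem variance_sum_hitInd_le (M : Finset (Fin n)) :
    𝔼 p, (∑ i ∈ M, (hitInd A i p - A.card / n)) ^ 2 ≤ M.card * (A.card / n) := by
  have h : ∀ p, (∑ i ∈ M, (hitInd A i p - (A.card : ℝ) / n)) ^ 2 =
      ∑ i ∈ M, ∑ j ∈ M, (hitInd A i p - A.card / n) * (hitInd A j p - A.card / n) := fun p => by
    rw [sq, Finset.sum_mul_sum]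
  have hc : ∀ i j, 𝔼 p, (hitInd A i p - A.card / n) * (hitInd A j p - A.card / n) =
      (𝔼 p, hitInd A i p * hitInd A j p) - ((A.card : ℝ) / n) ^ 2 := fun i j => by
    simp only [sub_mul, mul_sub, Finset.expect_sub_distrib, ← Finset.mul_expect,
      ← Finset.expect_mul, Fintype.expect_const, expect_hitInd]
    ring
  simp_rw [h]
  rw [Finset.expect_sum_comm, ← nsmul_eq_mul]
  refine Finset.sum_le_card_nsmul _ _ _ fun i hi => ?_
  rw [Finset.expect_sum_comm, ← Finset.add_sum_erase _ _ hi]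
  have h1 : ∑ j ∈ M.erase i, 𝔼 p, (hitInd A i p - A.card / n) * (hitInd A j p - A.card / n) ≤ 0 :=
    Finset.sum_nonpos fun j hj => by
      rw [hc]
      linarith [expect_hitInd_mul_le A (Finset.ne_of_mem_erase hj)]
  have h2 := hc i i
  simp_rw [hitInd_mul_self, expect_hitInd] at h2
  rw [h2]
  nlinarith [sq_nonneg ((A.card : ℝ) / n)]

end Hits

/-! ### Covariance of occurrences and hits -/

section Covariance

/-- The covariance of the indicators `occInd q I` and `hitInd A i`. -/
noncomputable def occHitCov {k n : ℕ} (q : Equiv.Perm (Fin k)) (A : Finset (Fin n))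
    (I : Fin k → Fin n) (i : Fin n) : ℝ :=
  (𝔼 p, occInd q I p * hitInd A i p) - (𝔼 p, occInd q I p) * (A.card / n)

variable {k n : ℕ} {q : Equiv.Perm (Fin k)} {A : Finset (Fin n)} {I : Fin k → Fin n}

theorem occHitCov_eq_zero {i : Fin n} (hi : i ∉ Finset.univ.image I) : occHitCov q A I i = 0 := by
  unfold occHitCov
  rw [(dependsOnOrderOn_occInd q I).expect_mul (invariantOn_hitInd A hi), expect_hitInd, sub_self]

theorem occHitCov_eq_zero_of_not_strictMono (hI : ¬ StrictMono I) (i : Fin n) :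
    occHitCov q A I i = 0 := by
  simp [occHitCov, occInd_eq_zero q hI]

theorem occHitCov_le (i : Fin n) : occHitCov q A I i ≤ A.card / n := by
  unfold occHitCov
  have h1 : 𝔼 p, occInd q I p * hitInd A i p ≤ A.card / n := by
    rw [← expect_hitInd A i]
    exact Finset.expect_le_expect fun p _ =>
      mul_le_of_le_one_left (hitInd_nonneg A i p) (occInd_le_one q I p)
  have h2 : 0 ≤ (𝔼 p, occInd q I p) * ((A.card : ℝ) / n) :=
    mul_nonneg (Finset.expect_nonneg fun p _ => occInd_nonneg q I p) (by positivity)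
  linarith

/-- If an entry of `A` in position `I a` forces an entry of `A` in position `I b` whenever `I` is
an occurrence, then the occurrences at `I` are negatively correlated with the hits at `I a`. -/
theorem occHitCov_le_neg (hI : StrictMono I) {a b : Fin k} (hab : b ≠ a)
    (hA : ∀ p, IsOccurrence q p I → p (I a) ∈ A → p (I b) ∈ A)
    (hAn : (A.card : ℝ) / n ≤ (2 * k.factorial : ℝ)⁻¹) :
    occHitCov q A I (I a) ≤ -((A.card : ℝ) / n * (2 * k.factorial : ℝ)⁻¹) := by
  unfold occHitCov
  -- An occurrence with a hit at `I a` forces two hits, hence the square. The product of the means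
  -- is at least `A.card / n` over k!, and `hAn` makes the square at most half of that.
  have h1 : 𝔼 p, occInd q I p * hitInd A (I a) p ≤ ((A.card : ℝ) / n) ^ 2 := by
    refine le_trans (Finset.expect_le_expect fun p _ => ?_)
      (expect_hitInd_mul_le A (hI.injective.ne hab))
    by_cases ho : IsOccurrence q p I
    · by_cases hp : p (I a) ∈ A
      · simp [occInd, hitInd, ho, hp, hA p ho hp]
      · simp [hitInd, hp]
    · simpa [occInd, ho] using mul_nonneg (hitInd_nonneg A (I a) p) (hitInd_nonneg A (I b) p)
  have h2 := mul_le_mul_of_nonneg_right (inv_factorial_le_expect_occInd q hI)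
    (show (0 : ℝ) ≤ A.card / n by positivity)
  have h3 : ((A.card : ℝ) / n) ^ 2 ≤ A.card / n * (2 * k.factorial : ℝ)⁻¹ := by
    rw [sq]; gcongr
  have h4 : ((k.factorial : ℝ))⁻¹ = 2 * (2 * k.factorial : ℝ)⁻¹ := by
    rw [mul_inv]; ring
  rw [h4] at h2
  linarith

theorem sum_occHitCov_eq (hI : StrictMono I) (M : Finset (Fin n)) :
    ∑ i ∈ M, occHitCov q A I i = ∑ a, if I a ∈ M then occHitCov q A I (I a) else 0 := by
  classical
  have h1 : ∑ i ∈ M, occHitCov q A I i =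
      ∑ i ∈ Finset.univ.image I, if i ∈ M then occHitCov q A I i else 0 := by
    rw [← Finset.sum_filter, Finset.filter_mem_eq_inter, Finset.inter_comm]
    refine (Finset.sum_subset Finset.inter_subset_left fun i hi hi' => ?_).symm
    exact occHitCov_eq_zero fun h => hi' (Finset.mem_inter.2 ⟨hi, h⟩)
  rw [h1, Finset.sum_image fun a _ b _ h => hI.injective h]

theorem expect_sub_mul_sub_eq_sum_occHitCov (q : Equiv.Perm (Fin k)) (A M : Finset (Fin n)) :
    𝔼 p, ((patternCount q p : ℝ) - 𝔼 p' : Equiv.Perm (Fin n), (patternCount q p' : ℝ)) *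
      ∑ i ∈ M, (hitInd A i p - A.card / n) =
      ∑ I : Fin k → Fin n, ∑ i ∈ M, occHitCov q A I i := by
  have h : ∀ p, ((patternCount q p : ℝ) - 𝔼 p' : Equiv.Perm (Fin n), (patternCount q p' : ℝ)) *
      ∑ i ∈ M, (hitInd A i p - A.card / n) =
      ∑ I : Fin k → Fin n, ∑ i ∈ M, (occInd q I p - 𝔼 p', occInd q I p') *
        (hitInd A i p - A.card / n) := fun p => by
    simp_rw [patternCount_eq_sum_occInd]
    rw [Finset.expect_sum_comm, ← Finset.sum_sub_distrib, Finset.sum_mul_sum]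
  simp_rw [h]
  rw [Finset.expect_sum_comm]
  refine Finset.sum_congr rfl fun I _ => ?_
  rw [Finset.expect_sum_comm]
  refine Finset.sum_congr rfl fun i _ => ?_
  simp only [sub_mul, mul_sub, Finset.expect_sub_distrib, ← Finset.mul_expect,
    ← Finset.expect_mul, Fintype.expect_const, expect_hitInd, occHitCov]
  ring

end Covariance

/-! ### Counting position sequences -/

section Counting

/-- The first `m` positions. -/
def initialPositions (n m : ℕ) : Finset (Fin n) := Finset.univ.filter fun i => (i : ℕ) < m

theorem card_initialPositions {n m : ℕ} (h : m ≤ n) : (initialPositions n m).card = m := by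
  have : initialPositions n m = (Finset.Ico 0 m).attachFin fun i hi => by
      rw [Finset.mem_Ico] at hi; omega := by
    ext i; simp [initialPositions]
  rw [this, Finset.card_attachFin, Nat.card_Ico, Nat.sub_zero]

/-- Here the initial segment serves as a set of values, not of positions. -/
theorem exists_lower_finset {n d : ℕ} (h : d ≤ n) :
    ∃ A : Finset (Fin n), A.card = d ∧ ∀ u ∈ A, ∀ v < u, v ∈ A :=
  ⟨initialPositions n d, card_initialPositions h, fun u hu v hv => by
    simp only [initialPositions, Finset.mem_filter, Finset.mem_univ, true_and] at hu ⊢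
    have : (v : ℕ) < u := hv
    omega⟩

theorem exists_upper_finset {n d : ℕ} (h : d ≤ n) :
    ∃ A : Finset (Fin n), A.card = d ∧ ∀ u ∈ A, ∀ v, u < v → v ∈ A :=
  ⟨(Finset.Ico (n - d) n).attachFin fun i hi => (Finset.mem_Ico.1 hi).2, by
    rw [Finset.card_attachFin, Nat.card_Ico]; omega, fun u hu v hv => by
    simp only [Finset.mem_attachFin, Finset.mem_Ico] at hu ⊢
    have : (u : ℕ) < v := hv
    have := v.2
    omega⟩

/-- Increasing position sequences that start among the first `m` positions are numerous. -/
theorem mul_pow_le_card_strictMono {k n m L : ℕ} (hm : m ≤ L) (hL : (k + 1) * L ≤ n) :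
    m * L ^ k ≤ (Finset.univ.filter fun I : Fin (k + 1) → Fin n =>
      StrictMono I ∧ I 0 ∈ initialPositions n m).card := by
  classical
  -- The entry with index `b` is chosen freely in the block starting at `b * L`, of width `L`,
  -- except that index 0 is confined to `m` places. The blocks are in increasing order, so every
  -- choice is strictly monotone.
  set w : Fin (k + 1) → ℕ := fun b => if b = 0 then m else L with hw
  have hwL : ∀ b, w b ≤ L := fun b => by simp only [hw]; split_ifs <;> omega
  have hbn : ∀ b : Fin (k + 1), b * L + L ≤ n := fun b => by
    have : (b : ℕ) + 1 ≤ k + 1 := b.2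
    calc b * L + L = (b + 1) * L := by ring
      _ ≤ (k + 1) * L := Nat.mul_le_mul_right _ this
      _ ≤ n := hL
  set s : Fin (k + 1) → Finset (Fin n) := fun b =>
    (Finset.Ico (b * L) (b * L + w b)).attachFin fun i hi => by
      have := (Finset.mem_Ico.1 hi).2
      have := hwL b
      have := hbn b
      omega with hs
  have hcard : (Fintype.piFinset s).card = m * L ^ k := by
    rw [Fintype.card_piFinset, Fin.prod_univ_succ]
    simp [hs, hw, Fin.succ_ne_zero]
  rw [← hcard]
  refine Finset.card_le_card fun I hI => ?_
  have hI' : ∀ b : Fin (k + 1), (b : ℕ) * L ≤ I b ∧ (I b : ℕ) < b * L + w b := fun b => by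
    have := Fintype.mem_piFinset.1 hI b
    simpa [hs] using this
  rw [Finset.mem_filter]
  refine ⟨Finset.mem_univ _, fun a b hab => ?_, ?_⟩
  · have h1 := (hI' a).2
    have h2 := (hI' b).1
    have h3 := hwL a
    have h4 : ((a : ℕ) + 1) * L ≤ b * L := Nat.mul_le_mul_right _ hab
    rw [Fin.lt_def]
    nlinarith
  · have := (hI' 0).2
    simpa [hw, initialPositions] using this

theorem card_two_initial_le {k n m : ℕ} (hm : m ≤ n) {a : Fin (k + 2)} (ha : a ≠ 0) :
    (Finset.univ.filter fun I : Fin (k + 2) → Fin n =>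
      I 0 ∈ initialPositions n m ∧ I a ∈ initialPositions n m).card ≤ m ^ 2 * n ^ k := by
  classical
  set s : Fin (k + 2) → Finset (Fin n) := fun b =>
    if b ∈ ({0, a} : Finset (Fin (k + 2))) then initialPositions n m else Finset.univ with hs
  have hcard : (Fintype.piFinset s).card = m ^ 2 * n ^ k := by
    rw [Fintype.card_piFinset]
    have : ∀ b, (s b).card = if b ∈ ({0, a} : Finset (Fin (k + 2))) then m else n := fun b => by
      simp only [hs]
      split_ifs
      · exact card_initialPositions hm
      · simp
    simp_rw [this]
    have h2 : ({0, a} : Finset (Fin (k + 2))).card = 2 := Finset.card_pair ha.symm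
    rw [Finset.prod_ite, Finset.prod_const, Finset.prod_const, Finset.filter_mem_eq_inter,
      Finset.univ_inter, h2, Finset.filter_not, Finset.card_sdiff_of_subset (Finset.filter_subset _ _),
      Finset.filter_mem_eq_inter, Finset.univ_inter, h2]
    simp
  rw [← hcard]
  refine Finset.card_le_card fun I hI => Fintype.mem_piFinset.2 fun b => ?_
  have h := (Finset.mem_filter.1 hI).2
  simp only [hs]
  split_ifs with hb
  · rw [Finset.mem_insert, Finset.mem_singleton] at hb
    rcases hb with rfl | rfl
    · exact h.1
    · exact h.2
  · exact Finset.mem_univ _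

end Counting

/-! ### Lower bound for the variance -/

section VarianceLowerBound

variable {k n : ℕ}

/-- If `q 1 < q 0` the lowest values work, otherwise the highest. -/
theorem exists_forcing_finset (q : Equiv.Perm (Fin (k + 2))) {d : ℕ} (h : d ≤ n) :
    ∃ A : Finset (Fin n), A.card = d ∧ ∀ (I : Fin (k + 2) → Fin n) (p : Equiv.Perm (Fin n)),
      IsOccurrence q p I → p (I 0) ∈ A → p (I 1) ∈ A := by
  rcases lt_or_gt_of_ne (q.injective.ne (show (1 : Fin (k + 2)) ≠ 0 by simp)) with hq | hq
  · obtain ⟨A, hA, hA'⟩ := exists_lower_finset h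
    exact ⟨A, hA, fun I p ho hp => hA' _ hp _ ((ho.2 1 0).1 hq)⟩
  · obtain ⟨A, hA, hA'⟩ := exists_upper_finset h
    exact ⟨A, hA, fun I p ho hp => hA' _ hp _ ((ho.2 0 1).1 hq)⟩

/-- The gain comes from `I 0` in the initial segment. Each of the other `k + 1` indices may lose at
most `A.card / n`, but only for sequences with two entries in that segment, which are rarer by a
factor of order m/n. -/
theorem sum_sum_occHitCov_le (q : Equiv.Perm (Fin (k + 2))) {A : Finset (Fin n)} {m L : ℕ}
    (hA : ∀ (I : Fin (k + 2) → Fin n) (p : Equiv.Perm (Fin n)),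
      IsOccurrence q p I → p (I 0) ∈ A → p (I 1) ∈ A)
    (hAn : (A.card : ℝ) / n ≤ (2 * (k + 2).factorial : ℝ)⁻¹) (hm : m ≤ L)
    (hL : (k + 2) * L ≤ n) :
    ∑ I : Fin (k + 2) → Fin n, ∑ i ∈ initialPositions n m, occHitCov q A I i ≤
      -((A.card : ℝ) / n * ((2 * (k + 2).factorial : ℝ)⁻¹ * (m * L ^ (k + 1)) -
        (k + 1) * (m ^ 2 * n ^ k))) := by
  classical
  set M := initialPositions n m with hM
  set α : ℝ := (A.card : ℝ) / n with hα
  have hα0 : 0 ≤ α := by positivity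
  set f : ℝ := (2 * (k + 2).factorial : ℝ)⁻¹ with hf
  have hmn : m ≤ n := by nlinarith
  have hI : ∀ I : Fin (k + 2) → Fin n, ∑ i ∈ M, occHitCov q A I i ≤
      -(α * f) * (if StrictMono I ∧ I 0 ∈ M then 1 else 0) +
        ∑ a ∈ Finset.univ.erase (0 : Fin (k + 2)), α * (if I 0 ∈ M ∧ I a ∈ M then 1 else 0) := by
    intro I
    by_cases hmono : StrictMono I
    · rw [sum_occHitCov_eq hmono, ← Finset.add_sum_erase _ _ (Finset.mem_univ 0)]
      refine add_le_add ?_ (Finset.sum_le_sum fun a _ => ?_)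
      · by_cases h0 : I 0 ∈ M
        · rw [if_pos h0, if_pos ⟨hmono, h0⟩, mul_one]
          exact occHitCov_le_neg hmono (a := 0) (b := 1) (by simp) (hA I) hAn
        · simp [h0]
      · by_cases ha : I a ∈ M
        · have h0 : I 0 ∈ M := by
            have : I 0 ≤ I a := hmono.monotone (Fin.zero_le a)
            simp only [hM, initialPositions, Finset.mem_filter, Finset.mem_univ, true_and] at ha ⊢
            exact lt_of_le_of_lt this ha
          simpa [h0, ha] using occHitCov_le (I a)
        · simp [ha]
    · rw [Finset.sum_eq_zero fun i _ => occHitCov_eq_zero_of_not_strictMono hmono i]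
      simp only [hmono, false_and, if_false, mul_zero, zero_add]
      exact Finset.sum_nonneg fun a _ => mul_nonneg hα0 (by split_ifs <;> norm_num)
  refine (Finset.sum_le_sum fun I _ => hI I).trans ?_
  rw [Finset.sum_add_distrib, ← Finset.mul_sum, Finset.sum_boole, Finset.sum_comm]
  have h1 : (m : ℝ) * L ^ (k + 1) ≤ ((Finset.univ.filter fun I : Fin (k + 2) → Fin n =>
      StrictMono I ∧ I 0 ∈ M).card : ℝ) := by
    exact_mod_cast mul_pow_le_card_strictMono hm hL
  have h2 : ∑ a ∈ Finset.univ.erase (0 : Fin (k + 2)), ∑ I : Fin (k + 2) → Fin n,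
      α * (if I 0 ∈ M ∧ I a ∈ M then (1 : ℝ) else 0) ≤ (k + 1) * (α * (m ^ 2 * n ^ k)) := by
    calc _ ≤ (Finset.univ.erase (0 : Fin (k + 2))).card • (α * ((m : ℝ) ^ 2 * n ^ k)) := by
          refine Finset.sum_le_card_nsmul _ _ _ fun a ha => ?_
          rw [← Finset.mul_sum, Finset.sum_boole]
          refine mul_le_mul_of_nonneg_left ?_ hα0
          exact_mod_cast card_two_initial_le hmn (Finset.ne_of_mem_erase ha)
      _ = _ := by simp
  have h3 : 0 ≤ α * f := by positivity
  nlinarith [mul_le_mul_of_nonneg_left h1 h3]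

theorem sq_expect_mul_le {Ω : Type*} [Fintype Ω] (f g : Ω → ℝ) :
    (𝔼 ω, f ω * g ω) ^ 2 ≤ (𝔼 ω, f ω ^ 2) * 𝔼 ω, g ω ^ 2 :=
  Finset.expect_mul_sq_le_sq_mul_sq _ _ _

theorem div_two_mul_le_natDiv {A n : ℕ} (hA : 0 < A) (h : A ≤ n) :
    (n : ℝ) / (2 * A) ≤ ((n / A : ℕ) : ℝ) := by
  rw [div_le_iff₀ (by positivity)]
  have h1 : 1 ≤ n / A := (Nat.one_le_div_iff hA).2 h
  have h2 := Nat.div_add_mod n A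
  have h3 := Nat.mod_lt n hA
  have : n ≤ n / A * (2 * A) := by nlinarith
  exact_mod_cast this

/-- The variance of the number of occurrences of a pattern of length `k + 2` is at least of order
`n ^ (2 * k + 3)`. -/
theorem exists_pos_mul_pow_le_variance (q : Equiv.Perm (Fin (k + 2))) :
    ∃ c : ℝ, 0 < c ∧ ∃ n₀ : ℕ, ∀ n ≥ n₀, c * (n : ℝ) ^ (2 * k + 3) ≤
      𝔼 p : Equiv.Perm (Fin n),
        ((patternCount q p : ℝ) - 𝔼 p' : Equiv.Perm (Fin n), (patternCount q p' : ℝ)) ^ 2 := by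
  obtain ⟨K, hK⟩ : ∃ K : ℕ, K = k + 2 := ⟨_, rfl⟩
  -- Chosen so that `K / B = κ`: with `m = n / B` the loss is at most `κ * (m * n ^ (k + 1))`, half
  -- of the lower bound `2 * κ * (m * n ^ (k + 1))` for the gain.
  set B : ℕ := 4 * K.factorial * K * (2 * K) ^ (k + 1) with hB
  have hF : 0 < K.factorial := Nat.factorial_pos _
  have hKpos : 0 < K := by omega
  have hBpos : 0 < B := by positivity
  set κ : ℝ := (4 * K.factorial * (2 * K) ^ (k + 1) : ℝ)⁻¹ with hκ
  have hκpos : 0 < κ := by positivity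
  refine ⟨(2 * B : ℝ)⁻¹ * (2 * B : ℝ)⁻¹ * κ ^ 2, by positivity, B, fun n hn => ?_⟩
  have hpow : 1 ≤ (2 * K) ^ (k + 1) := Nat.one_le_pow _ _ (by positivity)
  have hKB : K ≤ B := by
    have : 1 ≤ 4 * K.factorial := by omega
    calc K = 1 * K * 1 := by ring
      _ ≤ _ := by rw [hB]; gcongr
  have hFB : 2 * K.factorial ≤ B := by
    calc 2 * K.factorial = 2 * K.factorial * 1 * 1 := by ring
      _ ≤ _ := by rw [hB]; gcongr <;> omega
  have hnpos : 0 < n := hBpos.trans_le hn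
  have hn0 : (0 : ℝ) < n := by exact_mod_cast hnpos
  have hB0 : (0 : ℝ) < B := by exact_mod_cast hBpos
  set m := n / B with hm
  set L := n / K with hL
  have hmL : m ≤ L := Nat.div_le_div_left hKB (by omega)
  have hKL : (k + 2) * L ≤ n := hK ▸ Nat.mul_div_le n K
  have hm1 : (n : ℝ) / (2 * B) ≤ m := div_two_mul_le_natDiv hBpos hn
  have hm2 : (m : ℝ) ≤ n / B := Nat.cast_div_le
  have hL1 : (n : ℝ) / (2 * K) ≤ L := div_two_mul_le_natDiv (by omega) (hKB.trans hn)
  have hmpos : (0 : ℝ) < m := lt_of_lt_of_le (by positivity) hm1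
  obtain ⟨A, hAcard, hA⟩ := exists_forcing_finset q (show m ≤ n from Nat.div_le_self n B)
  set α : ℝ := (A.card : ℝ) / n with hα
  have hα1 : (2 * B : ℝ)⁻¹ ≤ α := by
    rw [hα, hAcard, le_div_iff₀ hn0]
    calc _ = (n : ℝ) / (2 * B) := by rw [mul_comm, div_eq_mul_inv]
      _ ≤ m := hm1
  have hα2 : α ≤ (B : ℝ)⁻¹ := by
    rw [hα, hAcard, div_le_iff₀ hn0]
    calc (m : ℝ) ≤ n / B := hm2
      _ = _ := by rw [mul_comm, div_eq_mul_inv]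
  have hαpos : 0 < α := lt_of_lt_of_le (by positivity) hα1
  have hα3 : α ≤ (2 * K.factorial : ℝ)⁻¹ := by
    refine hα2.trans ?_
    gcongr
    exact_mod_cast hFB
  have hcov := sum_sum_occHitCov_le q hA (hK ▸ hα3) hmL hKL
  rw [← expect_sub_mul_sub_eq_sum_occHitCov, ← hα] at hcov
  have hgain : κ * (m * n ^ (k + 1)) ≤
      (2 * K.factorial : ℝ)⁻¹ * (m * L ^ (k + 1)) - (k + 1) * (m ^ 2 * n ^ k) := by
    have e1 : (2 * K.factorial : ℝ)⁻¹ * (m * L ^ (k + 1)) ≥ 2 * κ * (m * n ^ (k + 1)) := by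
      have : ((n : ℝ) / (2 * K)) ^ (k + 1) ≤ L ^ (k + 1) := by gcongr
      calc 2 * κ * (m * n ^ (k + 1))
          = (2 * K.factorial : ℝ)⁻¹ * (m * ((n : ℝ) / (2 * K)) ^ (k + 1)) := by
            rw [hκ, div_pow]; field_simp; ring
        _ ≤ _ := by gcongr
    have e2 : ((k : ℝ) + 1) * (m ^ 2 * n ^ k) ≤ κ * (m * n ^ (k + 1)) := by
      have hKk : ((k : ℝ) + 1) ≤ K := by rw [hK]; push_cast; linarith
      have hKpos : (0 : ℝ) < K := by rw [hK]; push_cast; positivity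
      calc ((k : ℝ) + 1) * (m ^ 2 * n ^ k) ≤ K * (m * (n / B) * n ^ k) := by
            rw [sq]; gcongr
        _ = _ := by
            rw [hκ, hB]; push_cast; field_simp; ring
    linarith
  have hneg : α * (κ * (m * n ^ (k + 1))) ≤ -(𝔼 p : Equiv.Perm (Fin n),
      ((patternCount q p : ℝ) - 𝔼 p' : Equiv.Perm (Fin n), (patternCount q p' : ℝ)) *
      ∑ i ∈ initialPositions n m, (hitInd A i p - A.card / n)) := by
    have := mul_le_mul_of_nonneg_left hgain hαpos.le
    rw [hK] at this
    linarith
  -- Var Y ≤ `m * α`, so dividing the squared covariance by it leaves `α * m * κ ^ 2 * n ^ (2 * k +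
  -- 2)`; the factor `m` supplies the last power of `n`.
  have hcs := sq_expect_mul_le (fun p : Equiv.Perm (Fin n) => (patternCount q p : ℝ) -
    𝔼 p' : Equiv.Perm (Fin n), (patternCount q p' : ℝ))
    fun p => ∑ i ∈ initialPositions n m, (hitInd A i p - A.card / n)
  have hvarY := variance_sum_hitInd_le A (initialPositions n m)
  rw [card_initialPositions (Nat.div_le_self n B)] at hvarY
  set V := 𝔼 p : Equiv.Perm (Fin n), ((patternCount q p : ℝ) -
    𝔼 p' : Equiv.Perm (Fin n), (patternCount q p' : ℝ)) ^ 2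
  have hV0 : 0 ≤ V := Finset.expect_nonneg fun p _ => sq_nonneg _
  have hsq : (α * (κ * (m * n ^ (k + 1)))) ^ 2 ≤ V * (m * α) := by
    refine le_trans ?_ (hcs.trans (mul_le_mul_of_nonneg_left hvarY hV0))
    rw [← neg_sq (𝔼 p, _)]
    gcongr
  have hfin : α * m * κ ^ 2 * (n : ℝ) ^ (2 * k + 2) ≤ V := by
    refine le_of_mul_le_mul_right ?_ (show 0 < m * α by positivity)
    calc _ = (α * (κ * (m * n ^ (k + 1)))) ^ 2 := by ring
      _ ≤ _ := hsq
  calc _ = (2 * B : ℝ)⁻¹ * (n / (2 * B)) * κ ^ 2 * (n : ℝ) ^ (2 * k + 2) := by ring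
    _ ≤ α * m * κ ^ 2 * (n : ℝ) ^ (2 * k + 2) := by gcongr
    _ ≤ V := hfin

end VarianceLowerBound

/-! ### Asymptotic normality -/

section Normality

variable {k n : ℕ}

/-- The centered indicator of the event that `I` is an occurrence of `q`. -/
noncomputable def centeredOccInd (q : Equiv.Perm (Fin k)) (I : Fin k → Fin n)
    (p : Equiv.Perm (Fin n)) : ℝ :=
  occInd q I p - 𝔼 p' : Equiv.Perm (Fin n), occInd q I p'

variable (q : Equiv.Perm (Fin k))

theorem expect_centeredOccInd (I : Fin k → Fin n) : 𝔼 p, centeredOccInd q I p = 0 := by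
  simp [centeredOccInd, Finset.expect_sub_distrib]

theorem abs_centeredOccInd_le (I : Fin k → Fin n) (p : Equiv.Perm (Fin n)) :
    |centeredOccInd q I p| ≤ 1 := by
  have h1 : 0 ≤ 𝔼 p', occInd q I p' := Finset.expect_nonneg fun p _ => occInd_nonneg q I p
  have h2 : 𝔼 p', occInd q I p' ≤ 1 :=
    Finset.expect_le Finset.univ_nonempty fun p _ => occInd_le_one q I p
  have h3 := occInd_nonneg q I p
  have h4 := occInd_le_one q I p
  rw [abs_le, centeredOccInd]
  constructor <;> linarith

theorem sum_centeredOccInd (p : Equiv.Perm (Fin n)) :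
    ∑ I : Fin k → Fin n, centeredOccInd q I p =
      (patternCount q p : ℝ) - 𝔼 p' : Equiv.Perm (Fin n), (patternCount q p' : ℝ) := by
  simp_rw [centeredOccInd, patternCount_eq_sum_occInd]
  rw [Finset.expect_sum_comm, Finset.sum_sub_distrib]

theorem dependsOnOrderOn_centeredOccInd (I : Fin k → Fin n) :
    DependsOnOrderOn (Finset.univ.image I) (centeredOccInd q I) := fun p r h => by
  simp only [centeredOccInd, dependsOnOrderOn_occInd q I p r h]

/-- The position sequences `I` and `J` have a position in common. -/
def Overlap (I J : Fin k → Fin n) : Prop := ¬ Disjoint (Finset.univ.image I) (Finset.univ.image J)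

instance : DecidableRel (Overlap (k := k) (n := n)) := fun _ _ => instDecidableNot

theorem card_filter_apply_eq (b : Fin (k + 1)) (x : Fin n) :
    (Finset.univ.filter fun J : Fin (k + 1) → Fin n => J b = x).card ≤ n ^ k := by
  classical
  set s : Fin (k + 1) → Finset (Fin n) := fun c => if c = b then {x} else Finset.univ with hs
  have hcard : (Fintype.piFinset s).card = n ^ k := by
    rw [Fintype.card_piFinset, Fin.prod_univ_succAbove _ b]
    simp [hs, Fin.succAbove_ne]
  rw [← hcard]
  refine Finset.card_le_card fun J hJ => Fintype.mem_piFinset.2 fun c => ?_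
  simp only [hs]
  split_ifs with hc
  · rw [hc, Finset.mem_singleton]; exact (Finset.mem_filter.1 hJ).2
  · exact Finset.mem_univ _

/-- A union bound over the pairs of indices `(a, b)` with `J b = I a`. -/
theorem card_overlap_le (I : Fin (k + 1) → Fin n) :
    (Finset.univ.filter (Overlap I)).card ≤ (k + 1) ^ 2 * n ^ k := by
  classical
  have hsub : Finset.univ.filter (Overlap I) ⊆
      (Finset.univ : Finset (Fin (k + 1) × Fin (k + 1))).biUnion fun ab =>
        Finset.univ.filter fun J : Fin (k + 1) → Fin n => J ab.2 = I ab.1 := by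
    intro J hJ
    obtain ⟨x, hx, hy⟩ := Finset.not_disjoint_iff.1 (Finset.mem_filter.1 hJ).2
    obtain ⟨a, -, rfl⟩ := Finset.mem_image.1 hx
    obtain ⟨b, -, hb⟩ := Finset.mem_image.1 hy
    exact Finset.mem_biUnion.2 ⟨(a, b), Finset.mem_univ _, by simpa using hb⟩
  calc _ ≤ _ := Finset.card_le_card hsub
    _ ≤ (Finset.univ : Finset (Fin (k + 1) × Fin (k + 1))).card * n ^ k :=
        Finset.card_biUnion_le_card_mul _ _ _ fun ab _ => card_filter_apply_eq _ _
    _ = _ := by simp [sq]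

/-- Stein's bound with overlap as dependency graph. All maps `I` are indexed, including the
non-monotone ones, whose indicators vanish; this costs only constants and makes N a pure power of n.
-/
theorem norm_expect_exp_standardized_sub_le (q : Equiv.Perm (Fin (k + 1))) {σ : ℝ} (hσ : 0 < σ)
    (hσ2 : 𝔼 p : Equiv.Perm (Fin n),
      ((patternCount q p : ℝ) - 𝔼 p' : Equiv.Perm (Fin n), (patternCount q p' : ℝ)) ^ 2 = σ ^ 2)
    (t : ℝ) :
    ‖𝔼 p : Equiv.Perm (Fin n), Complex.exp (Complex.I * (t * (((patternCount q p : ℝ) -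
        𝔼 p' : Equiv.Perm (Fin n), (patternCount q p' : ℝ)) / σ) : ℝ)) -
        Complex.exp (-(t : ℂ) ^ 2 / 2)‖ ≤
      ((n : ℝ) ^ (k + 1) * ((k + 1) ^ 2 * n ^ k) ^ 2 / σ ^ 3 +
        √(8 * n ^ (k + 1) * ((k + 1) ^ 2 * n ^ k) ^ 3) / σ ^ 2) * (|t| + t ^ 2) * |t| := by
  simp_rw [← sum_centeredOccInd] at hσ2 ⊢
  have hdis : ∀ {I J : Fin (k + 1) → Fin n}, ¬ Overlap I J →
      Disjoint (Finset.univ.image I) (Finset.univ.image J) := fun h => not_not.1 h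
  have hmul : ∀ I J : Fin (k + 1) → Fin n,
      DependsOnOrderOn (Finset.univ.image I ∪ Finset.univ.image J)
        fun p => centeredOccInd q I p * centeredOccInd q J p := fun I J =>
    ((dependsOnOrderOn_centeredOccInd q I).mono Finset.subset_union_left).comp₂
      ((dependsOnOrderOn_centeredOccInd q J).mono Finset.subset_union_right) _
  have := norm_expect_exp_sub_le (fun I : Fin (k + 1) → Fin n => centeredOccInd q I) Overlap
    (fun I J h h' => h h'.symm) ((k + 1) ^ 2 * n ^ k) card_overlap_le (abs_centeredOccInd_le q)
    (fun I J h => by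
      rw [(dependsOnOrderOn_centeredOccInd q I).expect_mul
        ((dependsOnOrderOn_centeredOccInd q J).invariantOn (hdis h).symm), expect_centeredOccInd,
        zero_mul])
    (fun I s => by
      have hF : DependsOnOrderOn (Finset.univ.image I) fun p => (centeredOccInd q I p : ℂ) :=
        fun p p' h => by simp only [dependsOnOrderOn_centeredOccInd q I p p' h]
      have hG : InvariantOn (Finset.univ.image I) fun p : Equiv.Perm (Fin n) =>
          Complex.exp (Complex.I * (s * ∑ J with ¬ Overlap I J, centeredOccInd q J p : ℝ)) := by
        intro p τ hτ
        have : ∑ J with ¬ Overlap I J, centeredOccInd q J (p * τ) =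
            ∑ J with ¬ Overlap I J, centeredOccInd q J p :=
          Finset.sum_congr rfl fun J hJ => (dependsOnOrderOn_centeredOccInd q J).invariantOn
            (hdis (Finset.mem_filter.1 hJ).2).symm p τ hτ
        simp only [this]
      rw [hF.expect_mul hG, ← expect_ofReal, expect_centeredOccInd, Complex.ofReal_zero, zero_mul])
    (fun I J I' J' h1 h2 h3 h4 => (hmul I J).expect_mul ((hmul I' J').invariantOn (by
      rw [Finset.disjoint_union_left, Finset.disjoint_union_right, Finset.disjoint_union_right]
      exact ⟨⟨(hdis h1).symm, (hdis h3).symm⟩, (hdis h2).symm, (hdis h4).symm⟩)))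
    σ hσ hσ2 t
  simpa using this

theorem integral_uniformPerm {𝕜 : Type*} [RCLike 𝕜] (f : Equiv.Perm (Fin n) → 𝕜) :
    ∫ p, f p ∂uniformPerm n = 𝔼 p, f p := by
  rw [integral_fintype .of_finite, Fintype.expect_eq_sum_div_card, Finset.sum_div]
  refine Finset.sum_congr rfl fun p _ => ?_
  have : (uniformPerm n).real {p} = ((Fintype.card (Equiv.Perm (Fin n)) : ℝ))⁻¹ := by
    rw [Measure.real, uniformPerm, uniformOn_univ]
    simp
  rw [this, RCLike.real_smul_eq_coe_mul, div_eq_inv_mul]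
  simp

theorem variance_uniformPerm (X : Equiv.Perm (Fin n) → ℝ) :
    variance X (uniformPerm n) = 𝔼 p, (X p - 𝔼 p', X p') ^ 2 := by
  rw [variance_eq_integral Measurable.of_discrete.aemeasurable, integral_uniformPerm,
    integral_uniformPerm]

theorem charFun_map_uniformPerm (X : Equiv.Perm (Fin n) → ℝ) (t : ℝ) :
    charFun ((uniformPerm n).map X) t = 𝔼 p, Complex.exp (Complex.I * (t * X p : ℝ)) := by
  rw [charFun_apply_real, integral_map Measurable.of_discrete.aemeasurable
    (by fun_prop), integral_uniformPerm]
  refine Finset.expect_congr rfl fun p _ => ?_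
  congr 1
  push_cast
  ring

/-- The rate of convergence in terms of a lower bound for the variance. -/
theorem error_le_div_sqrt {c σ : ℝ} (hc : 0 < c) (hσ : 0 ≤ σ) (hn : 0 < n)
    (h : c * (n : ℝ) ^ (2 * k + 3) ≤ σ ^ 2) (d : ℝ) (hd : 0 ≤ d) :
    (n : ℝ) ^ (k + 2) * (d ^ 2 * n ^ (k + 1)) ^ 2 / σ ^ 3 +
        √(8 * n ^ (k + 2) * (d ^ 2 * n ^ (k + 1)) ^ 3) / σ ^ 2 ≤
      (d ^ 4 / √c ^ 3 + √8 * d ^ 3 / √c ^ 2) / √n := by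
  -- In powers of `u`, the two terms have exponents (6k+8) - (6k+9) and (4k+5) - (4k+6), both equal
  -- to -1.
  set u := √(n : ℝ) with hu
  have hu0 : 0 < u := Real.sqrt_pos.2 (by exact_mod_cast hn)
  have hun : (n : ℝ) = u ^ 2 := (Real.sq_sqrt (Nat.cast_nonneg n)).symm
  set s := √c with hs
  have hs0 : 0 < s := Real.sqrt_pos.2 hc
  have hsc : c = s ^ 2 := (Real.sq_sqrt hc.le).symm
  rw [hun, hsc] at h
  have hσs : s * u ^ (2 * k + 3) ≤ σ := by
    refine le_of_sq_le_sq ?_ hσ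
    refine le_trans (le_of_eq ?_) h
    ring
  have e : √(8 * (n : ℝ) ^ (k + 2) * (d ^ 2 * n ^ (k + 1)) ^ 3) = √8 * d ^ 3 * u ^ (4 * k + 5) := by
    rw [hun, show (8 : ℝ) * (u ^ 2) ^ (k + 2) * (d ^ 2 * (u ^ 2) ^ (k + 1)) ^ 3 =
      8 * (d ^ 3 * u ^ (4 * k + 5)) ^ 2 by ring, Real.sqrt_mul (by norm_num),
      Real.sqrt_sq (by positivity), mul_assoc]
  rw [e, hun]
  calc _ ≤ (u ^ 2) ^ (k + 2) * (d ^ 2 * (u ^ 2) ^ (k + 1)) ^ 2 / (s * u ^ (2 * k + 3)) ^ 3 +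
        √8 * d ^ 3 * u ^ (4 * k + 5) / (s * u ^ (2 * k + 3)) ^ 2 := by gcongr
    _ = _ := by field_simp; ring

theorem tendsto_charFun_standardize (q : Equiv.Perm (Fin (k + 2))) (t : ℝ) :
    Tendsto (fun n : ℕ => charFun ((uniformPerm n).map (standardize (uniformPerm n)
      fun p : Equiv.Perm (Fin n) => (patternCount q p : ℝ))) t) atTop
      (nhds (Complex.exp (-(t : ℂ) ^ 2 / 2))) := by
  obtain ⟨c, hc, n₀, hvar⟩ := exists_pos_mul_pow_le_variance q
  rw [tendsto_iff_norm_sub_tendsto_zero]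
  set C : ℝ := ((k + 2 : ℕ) : ℝ) ^ 4 / √c ^ 3 + √8 * ((k + 2 : ℕ) : ℝ) ^ 3 / √c ^ 2 with hC
  have hlim : Tendsto (fun n : ℕ => C / √(n : ℝ) * (|t| + t ^ 2) * |t|) atTop (nhds 0) := by
    have h1 : Tendsto (fun n : ℕ => C / √(n : ℝ)) atTop (nhds 0) :=
      (Real.tendsto_sqrt_atTop.comp tendsto_natCast_atTop_atTop).const_div_atTop C
    simpa using (h1.mul_const (|t| + t ^ 2)).mul_const |t|
  refine squeeze_zero' (Eventually.of_forall fun n => norm_nonneg _) ?_ hlim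
  -- For these `n` the variance is positive, so the convention for zero variance plays no role in
  -- the limit.
  filter_upwards [eventually_ge_atTop n₀, eventually_gt_atTop 0] with n hn hn0
  have hV := hvar n hn
  rw [← variance_uniformPerm] at hV
  have hn' : (0 : ℝ) < n := by exact_mod_cast hn0
  have hVpos := lt_of_lt_of_le (by positivity) hV
  set σ := √(variance (fun p : Equiv.Perm (Fin n) => (patternCount q p : ℝ)) (uniformPerm n)) with hσ
  have hσ0 : 0 < σ := Real.sqrt_pos.2 hVpos
  have hσ2 : variance (fun p : Equiv.Perm (Fin n) => (patternCount q p : ℝ)) (uniformPerm n) =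
      σ ^ 2 := (Real.sq_sqrt hVpos.le).symm
  have hmain := norm_expect_exp_standardized_sub_le q hσ0 ((variance_uniformPerm _).symm.trans hσ2) t
  rw [hσ2] at hV
  rw [charFun_map_uniformPerm]
  simp only [standardize, integral_uniformPerm]
  refine hmain.trans ?_
  have := error_le_div_sqrt hc hσ0.le hn0 hV ((k + 2 : ℕ) : ℝ) (by positivity)
  gcongr
  refine le_trans (le_of_eq ?_) this
  push_cast
  ring_nf

end Normality

theorem theorem2 (k : ℕ) (hk : 2 ≤ k) (q : Equiv.Perm (Fin k)) :
    TendstoInDistribution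
      (fun n : ℕ => standardize (uniformPerm n)
        (fun p : Equiv.Perm (Fin n) => (patternCount q p : ℝ)))
      atTop (id : ℝ → ℝ) uniformPerm (gaussianReal 0 1) := by
  -- The form `k + 2` gives the pattern the indices 0 and 1 compared in the variance bound.
  obtain ⟨k, rfl⟩ := Nat.exists_eq_add_of_le' hk
  refine ⟨fun n => Measurable.of_discrete.aemeasurable, aemeasurable_id, ?_⟩
  -- Lévy's continuity theorem.
  refine ProbabilityMeasure.tendsto_iff_tendsto_charFun.2 fun t => ?_
  have hgauss : charFun ((gaussianReal 0 1).map id) t = Complex.exp (-(t : ℂ) ^ 2 / 2) := by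
    rw [Measure.map_id, charFun_gaussianReal]
    simp [neg_div]
  simp only [ProbabilityMeasure.coe_mk]
  rw [hgauss]
  exact tendsto_charFun_standardize q t
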